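/- Let $0<\alpha<1$ and $\tau>0$. **Definitions.** For $t_0<t$, say that the Caputo derivative of $f$ with starting point $t_0$ exists at $t$ if $f$ is absolutely continuous on $[t_0,t]$ and $s\mapsto (t-s)^{-\alpha}f'(s)$ is integrable on $[t_0,t]$; then $${}^{C}D_{t_0}^{\alpha}f(t)=\frac{1}{\Gamma(1-\alpha)}\int_{t_0}^{t}(t-s)^{-\alpha}f'(s)\,ds .$$ Put $\omega_j^{(\alpha)}=\dfrac{(-1)^j\,\Gamma(\alpha+1)}{j!\,\Gamma(\alpha-j+1)}$ for $j\ge 0$. The modified Grünwald–Letnikov derivative of $y$ with initial function $\phi$ on $[-\tau,0]$ is $${}^{\phi_\tau}D_0^{\alpha}y(t)=\lim_{h\to0^+}\frac1{h^{\alpha}}\sum_{j=0}^{\infty}\omega_j^{(\alpha)}\,y^{\phi_\tau}(t-jh),\qquad y^{\phi_\tau}(s)=\begin{cases}\phi(-\tau), & s<-\tau,\\ \phi(s), & -\tau\le s\le 0,\\ y(s), & s>0;\end{cases}$$ it exists at $t$ if the series converges for every $h>0$ and the limit exists. The function $\phi$ is taken to be extended to the right of $0$ (by any extension for which the Caputo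 derivatives of $\phi$ required below exist). **Theorem.** (1) Let $t>0$ and $y(0)=\phi(0)$, and suppose that ${}^{C}D_0^{\alpha}y(t)$ and ${}^{C}D_{-\tau}^{\alpha}\phi(t)$ exist. Then ${}^{C}D_0^{\alpha}\phi(t)$ and ${}^{\phi_\tau}D_0^{\alpha}y(t)$ exist, and $${}^{\phi_\tau}D_0^{\alpha}y(t)={}^{C}D_0^{\alpha}y(t)+{}^{C}D_{-\tau}^{\alpha}\phi(t)-{}^{C}D_0^{\alpha}\phi(t).$$ (2) Let $T>0$ and $g:\mathbb R^3\to\mathbb R$, and suppose that ${}^{C}D_{-\tau}^{\alpha}\phi(t)$ exists for all $0<t\le T$. Let $y$ be a function on $[-\tau,T]$. The following are equivalent: (a) $y$ is continuous on $[-\tau,T]$, ${}^{C}D_0^{\alpha}y(t)$ exists for all $0<t\le T$, and $y$ solves $${}^{\phi_\tau}D_0^{\alpha}y(t)=g(t,y(t),y(t-\tau))\ \ (0<t\le T),\qquad y(t)=\phi(t)\ \ (-\tau\le t\le 0),$$ where it is part of the requirement that the derivative on the left exists; (b) $y$ is continuous on $[-\tau,T]$, ${}^{C}D_0^{\alpha}y(t)$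 exists for all $0<t\le T$, and $y$ solves $${}^{C}D_0^{\alpha}y(t)=g(t,y(t),y(t-\tau))+{}^{C}D_0^{\alpha}\phi(t)-{}^{C}D_{-\tau}^{\alpha}\phi(t)\ \ (0<t\le T),\qquad y(t)=\phi(t)\ \ (-\tau\le t\le 0).$$ -/

import Mathlib

open Set Filter Topology MeasureTheory

namespace FracDelay

noncomputable section

/-- The Riemann–Liouville integral `J_{t₀}^β f (t) = 1/Γ(β) ∫_{t₀}^t (t - s)^(β-1) f(s) ds`. -/
def rlIntegral (β t₀ : ℝ) (f : ℝ → ℝ) (t : ℝ) : ℝ :=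
  (1 / Real.Gamma β) * ∫ s in t₀..t, (t - s) ^ (β - 1) * f s

/-- The Caputo derivative of order `0 < α < 1` with starting point `t₀`:
`J_{t₀}^{1-α} y' (t)`. It is meaningful when `CaputoDifferentiableAt α t₀ y t` holds. -/
def caputoDeriv (α t₀ : ℝ) (y : ℝ → ℝ) (t : ℝ) : ℝ :=
  rlIntegral (1 - α) t₀ (deriv y) t

/-- The Caputo derivative of order `0 < α < 1` of `y` exists at `t`: the function is absolutely
continuous on `[t₀, t]` and the integral that defines the derivative converges absolutely. -/
def CaputoDifferentiableAt (α t₀ : ℝ) (y : ℝ → ℝ) (t : ℝ) : Prop :=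
  AbsolutelyContinuousOnInterval y t₀ t ∧
    IntervalIntegrable (fun s => (t - s) ^ (1 - α - 1) * deriv y s) volume t₀ t

/-- The Grünwald–Letnikov coefficients `ω_j^{(α)} = (-1)^j Γ(α+1) / (j! Γ(α-j+1))`. -/
def glCoeff (α : ℝ) (j : ℕ) : ℝ :=
  (-1) ^ j * Real.Gamma (α + 1) / ((j.factorial : ℝ) * Real.Gamma (α - (j : ℝ) + 1))

/-- The Grünwald–Letnikov derivative of `f` at `t` exists and equals `v`:
the series `∑_j ω_j^{(α)} f(t - j h)` converges for all step sizes `h > 0`, and its sum divided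
by `h^α` tends to `v` as `h → 0⁺`. -/
def HasGLDerivAt (α : ℝ) (f : ℝ → ℝ) (v t : ℝ) : Prop :=
  (∀ h : ℝ, 0 < h → Summable fun j : ℕ => glCoeff α j * f (t - (j : ℝ) * h)) ∧
    Tendsto (fun h : ℝ => (1 / h ^ α) * ∑' j : ℕ, glCoeff α j * f (t - (j : ℝ) * h))
      (𝓝[>] 0) (𝓝 v)

/-- The history `φ_τ`: equal to `φ(-τ)` before `-τ`, and to `φ` from `-τ` on
(only its values on `(-∞, 0]` are used). -/
def history (τ : ℝ) (φ : ℝ → ℝ) (t : ℝ) : ℝ :=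
  if t < -τ then φ (-τ) else φ t

/-- The function `y^{φ_τ}`: equal to `φ_τ` on `(-∞, 0]` and to `y` on `(0, ∞)`. -/
def extendByHistory (τ : ℝ) (φ y : ℝ → ℝ) (t : ℝ) : ℝ :=
  if t ≤ 0 then history τ φ t else y t

/-- The modified Grünwald–Letnikov derivative of `y` at `t`, with initial function `φ` on
`[-τ, 0]`, exists and equals `v`. -/
def HasModifiedGLDerivAt (α τ : ℝ) (φ y : ℝ → ℝ) (v t : ℝ) : Prop :=
  HasGLDerivAt α (extendByHistory τ φ y) v t

/-- `y` solves on `[-τ, T]` the delay problem with the modified derivative,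
`^{φ_τ}D_0^α y(t) = F(t, y(t), y(t-τ))` for `0 < t ≤ T`, and `y = φ` on `[-τ, 0]`. -/
structure IsModifiedSolution (α τ T : ℝ) (F : ℝ → ℝ → ℝ → ℝ) (φ y : ℝ → ℝ) : Prop where
  continuousOn : ContinuousOn y (Icc (-τ) T)
  initial : ∀ t ∈ Icc (-τ) 0, y t = φ t
  equation : ∀ t ∈ Ioc 0 T, HasModifiedGLDerivAt α τ φ y (F t (y t) (y (t - τ))) t

/-- `y` solves on `[-τ, T]` the delay problem with the Caputo derivative,
`^C D_0^α y(t) = F(t, y(t), y(t-τ))` for `0 < t ≤ T`, and `y = φ` on `[-τ, 0]`. -/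
structure IsCaputoSolution (α τ T : ℝ) (F : ℝ → ℝ → ℝ → ℝ) (φ y : ℝ → ℝ) : Prop where
  continuousOn : ContinuousOn y (Icc (-τ) T)
  initial : ∀ t ∈ Icc (-τ) 0, y t = φ t
  differentiable : ∀ t ∈ Ioc 0 T, CaputoDifferentiableAt α 0 y t
  equation : ∀ t ∈ Ioc 0 T, caputoDeriv α 0 y t = F t (y t) (y (t - τ))

end

end FracDelay

namespace FracDelay

open scoped Interval

/-! Let `G` be `φ'` on `[-τ, 0]` and `y'` on `(0, t]`. Since `y 0 = φ 0`, the extended function is a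
constant up to `-τ` and that constant plus the integral of `G` afterwards. The coefficients sum to
zero (`hasSum_glCoeff`), so the constant drops out, and exchanging sum and integral turns the
Grünwald–Letnikov sum into the integral of `G` against `glSum α ⌊(t - x) / h⌋₊`. Divided by `h ^ α`,
this kernel tends to `(t - x) ^ (-α) / Γ(1 - α)` and is at most `C * (t - x) ^ (-α)`, because `glSum
α n` decays like `n ^ (-α)`. Dominated convergence gives the Riemann–Liouville integral of `G`, and
splitting it at `0` gives the formula. The equivalence of the two problems then follows from
uniqueness of limits. -/

/-! ### Coefficients and their partial sums -/

lemma glCoeff_zero {α : ℝ} (hα : 0 < α) : glCoeff α 0 = 1 := by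
  have : Real.Gamma (α + 1) ≠ 0 := (Real.Gamma_pos_of_pos (by linarith)).ne'
  simp [glCoeff, this]

lemma glCoeff_succ {α : ℝ} (hα₀ : 0 < α) (hα₁ : α < 1) (j : ℕ) :
    glCoeff α (j + 1) = glCoeff α j * ((j - α) / (j + 1)) := by
  -- Noninteger `α` keeps `α - j` off the poles of Γ, where `Real.Gamma` has the default value 0.
  have hne : ∀ m : ℤ, α ≠ m := by
    intro m hm
    rw [hm] at hα₀ hα₁
    have h₀ : (0 : ℤ) < m := by exact_mod_cast hα₀
    have h₁ : m < (1 : ℤ) := by exact_mod_cast hα₁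
    omega
  have hj : α - j ≠ 0 := fun h => hne j (by push_cast; linarith)
  have hΓ : Real.Gamma (α - j) ≠ 0 := by
    refine Real.Gamma_ne_zero fun m hm => hne (j - m) ?_
    push_cast
    linarith
  have hrec := Real.Gamma_add_one hj
  have hshift : α - ((j + 1 : ℕ) : ℝ) + 1 = α - j := by push_cast; ring
  rw [glCoeff, glCoeff, hshift, hrec, Nat.factorial_succ]
  have hj₁ : (j : ℝ) + 1 ≠ 0 := by positivity
  have hf : (j.factorial : ℝ) ≠ 0 := by positivity
  push_cast
  field_simp
  ring

/-- The partial sums of the Grünwald–Letnikov coefficients. -/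
noncomputable def glSum (α : ℝ) (n : ℕ) : ℝ := ∑ j ∈ Finset.range (n + 1), glCoeff α j

/-- Gives the sign of every later coefficient and the ratio `(n + 1 - α) / (n + 1)` of successive
partial sums, hence their product form. -/
lemma glCoeff_succ_eq_glSum {α : ℝ} (hα₀ : 0 < α) (hα₁ : α < 1) (n : ℕ) :
    glCoeff α (n + 1) = -α / (n + 1) * glSum α n := by
  induction n with
  | zero => simp [glSum, glCoeff_succ hα₀ hα₁, glCoeff_zero hα₀]
  | succ n ih =>
    rw [glSum, Finset.sum_range_succ, ← glSum, glCoeff_succ hα₀ hα₁, ih]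
    have : (n : ℝ) + 1 ≠ 0 := by positivity
    have : (n : ℝ) + 1 + 1 ≠ 0 := by positivity
    push_cast
    field_simp
    ring

lemma glSum_eq_prod {α : ℝ} (hα₀ : 0 < α) (hα₁ : α < 1) (n : ℕ) :
    glSum α n = (∏ k ∈ Finset.range n, (1 - α + k)) / n.factorial := by
  induction n with
  | zero => simp [glSum, glCoeff_zero hα₀]
  | succ n ih =>
    rw [glSum, Finset.sum_range_succ, ← glSum, glCoeff_succ_eq_glSum hα₀ hα₁, ih,
      Finset.prod_range_succ, Nat.factorial_succ]
    have : (n : ℝ) + 1 ≠ 0 := by positivity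
    have : (n.factorial : ℝ) ≠ 0 := by positivity
    push_cast
    field_simp
    ring

lemma glSum_pos {α : ℝ} (hα₀ : 0 < α) (hα₁ : α < 1) (n : ℕ) : 0 < glSum α n := by
  rw [glSum_eq_prod hα₀ hα₁]
  have : ∀ k ∈ Finset.range n, 0 < 1 - α + k := fun k _ => by
    have : (0 : ℝ) ≤ k := k.cast_nonneg
    linarith
  have := Finset.prod_pos this
  positivity

/-- The partial sums of the Grünwald–Letnikov coefficients are asymptotic to
`n ^ (-α) / Γ(1 - α)`. -/
lemma tendsto_glSum_mul_rpow {α : ℝ} (hα₀ : 0 < α) (hα₁ : α < 1) :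
    Tendsto (fun n : ℕ => glSum α n * ((n : ℝ) + 1) ^ α) atTop
      (𝓝 (1 / Real.Gamma (1 - α))) := by
  -- `Real.GammaSeq (1 - α) n` has `n + 1` factors in its denominator, as many as `glSum α (n + 1)`
  -- has in its numerator.
  rw [← tendsto_add_atTop_iff_nat 1]
  have hΓ : Real.Gamma (1 - α) ≠ 0 := (Real.Gamma_pos_of_pos (by linarith)).ne'
  have h₁ := (Real.GammaSeq_tendsto_Gamma (1 - α)).inv₀ hΓ
  have h₂ : Tendsto (fun n : ℕ => (1 + 2 / (n : ℝ)) ^ α) atTop (𝓝 1) := by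
    have := (tendsto_const_nhds (x := (1 : ℝ))).add (tendsto_const_div_atTop_nhds_zero_nat 2)
    simpa using this.rpow_const (p := α) (by simp)
  have h₃ : Tendsto (fun n : ℕ => (n : ℝ) / (n + 1)) atTop (𝓝 1) :=
    tendsto_natCast_div_add_atTop 1
  have h := (h₁.mul h₂).mul h₃
  rw [mul_one, mul_one, ← one_div] at h
  refine h.congr' ?_
  filter_upwards [eventually_gt_atTop 0] with n hn
  have hn' : (0 : ℝ) < n := by exact_mod_cast hn
  have e : 1 + 2 / (n : ℝ) = (n + 2) / n := by field_simp
  rw [Real.GammaSeq, glSum_eq_prod hα₀ hα₁, e, Real.div_rpow (by positivity) hn'.le,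
    Real.rpow_sub hn', Real.rpow_one, Nat.factorial_succ]
  have : (n : ℝ) ^ α ≠ 0 := by positivity
  have : (n.factorial : ℝ) ≠ 0 := by positivity
  have e' : (((n + 1 : ℕ) : ℝ) + 1) = n + 2 := by push_cast; ring
  rw [e']
  push_cast
  field_simp

lemma exists_glSum_mul_rpow_le {α : ℝ} (hα₀ : 0 < α) (hα₁ : α < 1) :
    ∃ C : ℝ, ∀ n : ℕ, glSum α n * ((n : ℝ) + 1) ^ α ≤ C := by
  obtain ⟨C, hC⟩ := (tendsto_glSum_mul_rpow hα₀ hα₁).bddAbove_range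
  exact ⟨C, fun n => hC ⟨n, rfl⟩⟩

lemma tendsto_glSum {α : ℝ} (hα₀ : 0 < α) (hα₁ : α < 1) :
    Tendsto (glSum α) atTop (𝓝 0) := by
  have h₁ : Tendsto (fun n : ℕ => ((n : ℝ) + 1) ^ (-α)) atTop (𝓝 0) :=
    (tendsto_rpow_neg_atTop hα₀).comp
      (tendsto_atTop_add_const_right _ _ tendsto_natCast_atTop_atTop)
  have h := (tendsto_glSum_mul_rpow hα₀ hα₁).mul h₁
  rw [mul_zero] at h
  refine h.congr fun n => ?_
  rw [mul_assoc, ← Real.rpow_add (by positivity), add_neg_cancel, Real.rpow_zero, mul_one]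

/-- All coefficients after the first are negative, so convergence of the partial sums to 0 already
gives unconditional summability. -/
lemma hasSum_glCoeff {α : ℝ} (hα₀ : 0 < α) (hα₁ : α < 1) : HasSum (glCoeff α) 0 := by
  have h : HasSum (fun j => -glCoeff α (j + 1)) 1 := by
    rw [hasSum_iff_tendsto_nat_of_nonneg]
    · have := (tendsto_glSum hα₀ hα₁).const_sub 1
      rw [sub_zero] at this
      refine this.congr fun n => ?_
      rw [glSum, Finset.sum_range_succ', glCoeff_zero hα₀, Finset.sum_neg_distrib]
      ring
    · intro j
      rw [glCoeff_succ_eq_glSum hα₀ hα₁, neg_mul_eq_neg_mul]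
      have := glSum_pos hα₀ hα₁ j
      have : -(-α / ((j : ℝ) + 1)) = α / (j + 1) := by ring
      rw [this]
      positivity
  rw [← hasSum_nat_add_iff' 1]
  simpa [glCoeff_zero hα₀] using h.neg

/-! ### The rescaled kernel -/

lemma tendsto_scaled_glSum_floor {α : ℝ} (hα₀ : 0 < α) (hα₁ : α < 1) {x : ℝ} (hx : 0 < x) :
    Tendsto (fun h : ℝ => 1 / h ^ α * glSum α ⌊x / h⌋₊) (𝓝[>] 0)
      (𝓝 (1 / Real.Gamma (1 - α) * x ^ (-α))) := by
  have hinv : Tendsto (fun h : ℝ => x / h) (𝓝[>] 0) atTop := by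
    simpa [div_eq_mul_inv] using tendsto_inv_nhdsGT_zero.const_mul_atTop hx
  have hfl : Tendsto (fun h : ℝ => ⌊x / h⌋₊) (𝓝[>] 0) atTop :=
    tendsto_nat_floor_atTop.comp hinv
  have h₁ := (tendsto_glSum_mul_rpow hα₀ hα₁).comp hfl
  have h₀ : Tendsto (fun h : ℝ => h) (𝓝[>] 0) (𝓝 0) := tendsto_nhdsWithin_of_tendsto_nhds tendsto_id
  have h₂ : Tendsto (fun h : ℝ => ((⌊x / h⌋₊ : ℝ) + 1) * h) (𝓝[>] 0) (𝓝 x) := by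
    have hup : Tendsto (fun h : ℝ => x + h) (𝓝[>] 0) (𝓝 x) := by
      simpa using h₀.const_add x
    refine tendsto_of_tendsto_of_tendsto_of_le_of_le' tendsto_const_nhds hup ?_ ?_
    · filter_upwards [self_mem_nhdsWithin] with h (hh : 0 < h)
      exact ((div_lt_iff₀ hh).1 (Nat.lt_floor_add_one _)).le
    · filter_upwards [self_mem_nhdsWithin] with h (hh : 0 < h)
      have := (le_div_iff₀ hh).1 (Nat.floor_le (div_pos hx hh).le)
      linarith
  refine (h₁.mul (h₂.rpow_const (p := -α) (Or.inl hx.ne'))).congr' ?_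
  filter_upwards [self_mem_nhdsWithin] with h (hh : 0 < h)
  simp only [Function.comp]
  have hn : (0 : ℝ) < (⌊x / h⌋₊ : ℝ) + 1 := by positivity
  rw [Real.mul_rpow hn.le hh.le, Real.rpow_neg hn.le, Real.rpow_neg hh.le]
  have := Real.rpow_pos_of_pos hn α
  have := Real.rpow_pos_of_pos hh α
  field_simp

/-- The domination, uniform in `h`: it rests on `x < (⌊x / h⌋₊ + 1) * h`, so it holds even when the
floor is 0. -/
lemma scaled_glSum_floor_le {α C : ℝ} (hα₀ : 0 < α) (hα₁ : α < 1)
    (hC : ∀ n : ℕ, glSum α n * ((n : ℝ) + 1) ^ α ≤ C) {x h : ℝ} (hx : 0 < x) (hh : 0 < h) :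
    1 / h ^ α * glSum α ⌊x / h⌋₊ ≤ C * x ^ (-α) := by
  have hn : (0 : ℝ) < (⌊x / h⌋₊ : ℝ) + 1 := by positivity
  have hle : x ^ α ≤ ((⌊x / h⌋₊ : ℝ) + 1) ^ α * h ^ α := by
    rw [← Real.mul_rpow hn.le hh.le]
    exact Real.rpow_le_rpow hx.le ((div_lt_iff₀ hh).1 (Nat.lt_floor_add_one _)).le hα₀.le
  have hhα := Real.rpow_pos_of_pos hh α
  have hxα := Real.rpow_pos_of_pos hx α
  have hs := (glSum_pos hα₀ hα₁ ⌊x / h⌋₊).le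
  rw [Real.rpow_neg hx.le, ← div_eq_mul_inv, le_div_iff₀ hxα, one_div, inv_mul_eq_div,
    div_mul_eq_mul_div, div_le_iff₀ hhα]
  calc glSum α ⌊x / h⌋₊ * x ^ α
      ≤ glSum α ⌊x / h⌋₊ * (((⌊x / h⌋₊ : ℝ) + 1) ^ α * h ^ α) :=
        mul_le_mul_of_nonneg_left hle hs
    _ = glSum α ⌊x / h⌋₊ * ((⌊x / h⌋₊ : ℝ) + 1) ^ α * h ^ α := by ring
    _ ≤ C * h ^ α := mul_le_mul_of_nonneg_right (hC _) hhα.le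

/-! ### From sums to integrals -/

/-- If `f` is constant up to `a` and is a primitive of `G` on `[a, t]`, its Grünwald–Letnikov sums
are integrals of `G` against a step function. -/
lemma hasSum_glCoeff_mul_primitive {α a t c h : ℝ} {f G : ℝ → ℝ} (hα₀ : 0 < α) (hα₁ : α < 1)
    (hat : a ≤ t) (hh : 0 < h) (hG : IntervalIntegrable G volume a t)
    (hleft : ∀ s ≤ a, f s = c) (hf : ∀ s ∈ Ioc a t, f s = c + ∫ x in a..s, G x) :
    HasSum (fun j : ℕ => glCoeff α j * f (t - j * h))
      (∫ x in a..t, glSum α ⌊(t - x) / h⌋₊ * G x) := by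
  -- Truncating `G` puts all the integrals on the same interval, including those for grid points
  -- below `a`, where they vanish.
  set K : ℕ → ℝ → ℝ := fun j => (Iic (t - j * h)).indicator G with hK
  have hGon : IntegrableOn G (Ioc a t) := (intervalIntegrable_iff_integrableOn_Ioc_of_le hat).1 hG
  have hKint : ∀ j, IntervalIntegrable (K j) volume a t := fun j =>
    (intervalIntegrable_iff_integrableOn_Ioc_of_le hat).2 (hGon.indicator measurableSet_Iic)
  have hKzero : ∀ j : ℕ, t - j * h ≤ a → ∫ x in a..t, K j x = 0 := by
    intro j hj
    rw [intervalIntegral.integral_of_le hat]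
    refine setIntegral_eq_zero_of_forall_eq_zero fun x hx => ?_
    have hx' : x ∉ Iic (t - j * h) := not_le.2 (hj.trans_lt hx.1)
    simp only [hK]
    rw [indicator_of_notMem hx']
  have hval : ∀ j : ℕ, f (t - j * h) = c + ∫ x in a..t, K j x := by
    intro j
    rcases le_or_gt (t - j * h) a with hj | hj
    · rw [hleft _ hj, hKzero j hj, add_zero]
    · have hjt : t - j * h ≤ t := by
        have : 0 ≤ (j : ℝ) * h := by positivity
        linarith
      rw [hf _ ⟨hj, hjt⟩, intervalIntegral.integral_of_le hat,
        intervalIntegral.integral_of_le hj.le, setIntegral_indicator measurableSet_Iic,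
        Ioc_inter_Iic, min_eq_right hjt]
  have hconst : HasSum (fun j : ℕ => glCoeff α j * c) 0 := by
    simpa using (hasSum_glCoeff hα₀ hα₁).mul_right c
  -- The indices `j` whose truncation keeps `x` are exactly those up to the floor, so their
  -- coefficients add up to `glSum`.
  have hle_floor : ∀ (j : ℕ) {x : ℝ}, x ≤ t → (j ≤ ⌊(t - x) / h⌋₊ ↔ x ≤ t - j * h) := by
    intro j x hx
    rw [Nat.le_floor_iff (div_nonneg (by linarith) hh.le), le_div_iff₀ hh]
    constructor <;> intro h <;> linarith
  have hfin : HasSum (fun j : ℕ => glCoeff α j * ∫ x in a..t, K j x)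
      (∑ j ∈ Finset.range (⌊(t - a) / h⌋₊ + 1), glCoeff α j * ∫ x in a..t, K j x) := by
    refine hasSum_sum_of_ne_finset_zero fun j hj => ?_
    rw [Finset.mem_range, Nat.lt_succ_iff, hle_floor j hat, not_le] at hj
    rw [hKzero j hj.le, mul_zero]
  have hsum := hconst.add hfin
  have hint : (∑ j ∈ Finset.range (⌊(t - a) / h⌋₊ + 1), glCoeff α j * ∫ x in a..t, K j x)
      = ∫ x in a..t, glSum α ⌊(t - x) / h⌋₊ * G x := by
    simp_rw [← intervalIntegral.integral_const_mul]
    rw [← intervalIntegral.integral_finsetSum fun j _ => (hKint j).const_mul _]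
    rw [intervalIntegral.integral_of_le hat, intervalIntegral.integral_of_le hat]
    refine setIntegral_congr_fun measurableSet_Ioc fun x hx => ?_
    have hfl : ⌊(t - x) / h⌋₊ ≤ ⌊(t - a) / h⌋₊ :=
      Nat.floor_le_floor (div_le_div_of_nonneg_right (by linarith [hx.1]) hh.le)
    simp only [glSum, Finset.sum_mul]
    refine (Finset.sum_subset (Finset.range_mono (Nat.succ_le_succ hfl)) fun j _ hj => ?_).symm.trans
      (Finset.sum_congr rfl fun j hj => ?_)
    · rw [Finset.mem_range, Nat.lt_succ_iff, hle_floor j hx.2] at hj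
      simp only [hK]
      rw [indicator_of_notMem (by exact hj), mul_zero]
    · rw [Finset.mem_range, Nat.lt_succ_iff, hle_floor j hx.2] at hj
      simp only [hK]
      rw [indicator_of_mem (by exact hj)]
  rw [zero_add, hint] at hsum
  simpa only [hval, mul_add] using hsum

/-- The Grünwald–Letnikov derivative of a function that is constant up to `a` and a primitive
of `G` on `[a, t]` is the Riemann–Liouville integral of `G` of order `1 - α`. -/
theorem hasGLDerivAt_of_primitive {α a t c : ℝ} {f G : ℝ → ℝ} (hα₀ : 0 < α) (hα₁ : α < 1)
    (hat : a ≤ t) (hG : IntervalIntegrable G volume a t)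
    (hw : IntervalIntegrable (fun s => (t - s) ^ (1 - α - 1) * G s) volume a t)
    (hleft : ∀ s ≤ a, f s = c) (hf : ∀ s ∈ Ioc a t, f s = c + ∫ x in a..s, G x) :
    HasGLDerivAt α f (rlIntegral (1 - α) a G t) t := by
  refine ⟨fun h hh => (hasSum_glCoeff_mul_primitive hα₀ hα₁ hat hh hG hleft hf).summable, ?_⟩
  have hexp : 1 - α - 1 = -α := by ring
  rw [hexp] at hw
  obtain ⟨C, hC⟩ := exists_glSum_mul_rpow_le hα₀ hα₁
  -- The bound and the limit of the kernel need `x < t`; the endpoint is a null set.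
  have hpos : ∀ᵐ x : ℝ, x ∈ Ι a t → 0 < t - x := by
    filter_upwards [Measure.ae_ne volume t] with x hx hxm
    rw [uIoc_of_le hat] at hxm
    exact sub_pos.2 (lt_of_le_of_ne hxm.2 hx)
  have key : Tendsto (fun h : ℝ => ∫ x in a..t, 1 / h ^ α * glSum α ⌊(t - x) / h⌋₊ * G x)
      (𝓝[>] 0) (𝓝 (∫ x in a..t, 1 / Real.Gamma (1 - α) * (t - x) ^ (-α) * G x)) := by
    refine intervalIntegral.tendsto_integral_filter_of_dominated_convergence
      (fun x => C * ‖(t - x) ^ (-α) * G x‖) (Eventually.of_forall fun h => ?_) ?_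
      (hw.norm.const_mul C) ?_
    · refine AEStronglyMeasurable.mul ?_ hG.aestronglyMeasurable_restrict_uIoc
      refine (Measurable.const_mul ?_ _).aestronglyMeasurable
      exact (measurable_from_nat (f := glSum α)).comp
        (Nat.measurable_floor.comp ((measurable_const.sub measurable_id).div_const h))
    · filter_upwards [self_mem_nhdsWithin] with h (hh : 0 < h)
      filter_upwards [hpos] with x hx hxm
      have hle := scaled_glSum_floor_le hα₀ hα₁ hC (hx hxm) hh
      have hnn : 0 ≤ 1 / h ^ α * glSum α ⌊(t - x) / h⌋₊ :=
        mul_nonneg (by positivity) (glSum_pos hα₀ hα₁ _).le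
      rw [norm_mul, Real.norm_of_nonneg hnn, norm_mul,
        Real.norm_of_nonneg (Real.rpow_nonneg (hx hxm).le _), ← mul_assoc]
      exact mul_le_mul_of_nonneg_right hle (norm_nonneg _)
    · filter_upwards [hpos] with x hx hxm
      exact (tendsto_scaled_glSum_floor hα₀ hα₁ (hx hxm)).mul_const _
  simp_rw [mul_assoc, intervalIntegral.integral_const_mul] at key
  rw [rlIntegral, hexp]
  refine key.congr' ?_
  filter_upwards [self_mem_nhdsWithin] with h (hh : 0 < h)
  rw [(hasSum_glCoeff_mul_primitive hα₀ hα₁ hat hh hG hleft hf).tsum_eq]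

/-! ### Gluing the history to the solution -/

lemma intervalIntegral_congr_uIoc {a b : ℝ} {f g : ℝ → ℝ} (h : EqOn f g (Ι a b)) :
    ∫ x in a..b, f x = ∫ x in a..b, g x :=
  intervalIntegral.integral_congr_ae (ae_of_all _ fun _ hx => h hx)

lemma CaputoDifferentiableAt.mono_left {α a b t : ℝ} {f : ℝ → ℝ} (hab : a ≤ b) (hbt : b ≤ t)
    (hf : CaputoDifferentiableAt α a f t) : CaputoDifferentiableAt α b f t := by
  have hsub : uIcc b t ⊆ uIcc a t := by
    rw [uIcc_of_le hbt, uIcc_of_le (hab.trans hbt)]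
    exact Icc_subset_Icc_left hab
  exact ⟨hf.1.mono hsub, hf.2.mono_set hsub⟩

/-- The modified Grünwald–Letnikov derivative in terms of Caputo derivatives. -/
theorem hasModifiedGLDerivAt_of_caputo {α τ t : ℝ} {φ y : ℝ → ℝ} (hα₀ : 0 < α) (hα₁ : α < 1)
    (hτ : 0 ≤ τ) (ht : 0 < t) (h₀ : y 0 = φ 0) (hy : CaputoDifferentiableAt α 0 y t)
    (hφ : CaputoDifferentiableAt α (-τ) φ t) :
    HasModifiedGLDerivAt α τ φ y
      (caputoDeriv α 0 y t + caputoDeriv α (-τ) φ t - caputoDeriv α 0 φ t) t := by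
  have hτ' : -τ ≤ 0 := by linarith
  have hφ₀ := hφ.mono_left hτ' ht.le
  set G : ℝ → ℝ := fun x => if x ≤ 0 then deriv φ x else deriv y x with hGdef
  have hsub : uIcc (-τ) 0 ⊆ uIcc (-τ) t := by
    rw [uIcc_of_le hτ', uIcc_of_le (hτ'.trans ht.le)]
    exact Icc_subset_Icc_right ht.le
  have hGneg : ∀ {s : ℝ}, s ≤ 0 → -τ ≤ s → EqOn (deriv φ) G (Ι (-τ) s) := by
    intro s hs hs' x hx
    rw [uIoc_of_le hs'] at hx
    simp [hGdef, hx.2.trans hs]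
  have hGpos : ∀ {s : ℝ}, 0 ≤ s → EqOn (deriv y) G (Ι 0 s) := by
    intro s hs x hx
    rw [uIoc_of_le hs] at hx
    simp [hGdef, not_le.2 hx.1]
  have hGi₁ : IntervalIntegrable G volume (-τ) 0 :=
    (hφ.1.intervalIntegrable_deriv.mono_set hsub).congr (hGneg le_rfl hτ')
  have hGi₂ : IntervalIntegrable G volume 0 t :=
    hy.1.intervalIntegrable_deriv.congr (hGpos ht.le)
  have hw₁ : IntervalIntegrable (fun s => (t - s) ^ (1 - α - 1) * G s) volume (-τ) 0 :=
    (hφ.2.mono_set hsub).congr fun x hx => by simp only [hGneg le_rfl hτ' hx]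
  have hw₂ : IntervalIntegrable (fun s => (t - s) ^ (1 - α - 1) * G s) volume 0 t :=
    hy.2.congr fun x hx => by simp only [hGpos ht.le hx]
  have hintneg : ∀ s, s ≤ 0 → -τ ≤ s → ∫ x in (-τ)..s, G x = φ s - φ (-τ) := by
    intro s hs hs'
    rw [← intervalIntegral_congr_uIoc (hGneg hs hs')]
    refine (hφ.1.mono ?_).integral_deriv_eq_sub
    rw [uIcc_of_le hs', uIcc_of_le (hτ'.trans ht.le)]
    exact Icc_subset_Icc_right (hs.trans ht.le)
  have hmain : HasGLDerivAt α (extendByHistory τ φ y) (rlIntegral (1 - α) (-τ) G t) t := by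
    refine hasGLDerivAt_of_primitive (c := φ (-τ)) hα₀ hα₁ (hτ'.trans ht.le)
      (hGi₁.trans hGi₂) (hw₁.trans hw₂) ?_ ?_
    · intro s hs
      rcases hs.lt_or_eq with hs | rfl
      · simp [extendByHistory, history, hs, hs.le.trans hτ']
      · simp [extendByHistory, history, hτ]
    · intro s hs
      rcases le_or_gt s 0 with hs₀ | hs₀
      · rw [hintneg s hs₀ hs.1.le]
        simp [extendByHistory, history, hs₀, not_lt.2 hs.1.le]
      · have hsub' : uIcc 0 s ⊆ uIcc 0 t := by
          rw [uIcc_of_le hs₀.le, uIcc_of_le ht.le]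
          exact Icc_subset_Icc_right hs.2
        -- The increments of `φ` over `[-τ, 0]` and of `y` over `[0, s]` telescope because `y 0 = φ
        -- 0`.
        rw [← intervalIntegral.integral_add_adjacent_intervals hGi₁ (hGi₂.mono_set hsub'),
          hintneg 0 le_rfl hτ', ← intervalIntegral_congr_uIoc (hGpos hs₀.le),
          (hy.1.mono hsub').integral_deriv_eq_sub, h₀]
        simp [extendByHistory, not_le.2 hs₀]
  -- The integrals of `φ'` over `[0, t]` cancel, so the extension of `φ` past 0 does not affect the
  -- value.
  have hvalue : caputoDeriv α 0 y t + caputoDeriv α (-τ) φ t - caputoDeriv α 0 φ t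
      = rlIntegral (1 - α) (-τ) G t := by
    simp only [caputoDeriv, rlIntegral]
    rw [← intervalIntegral.integral_add_adjacent_intervals hw₁ hw₂,
      ← intervalIntegral.integral_add_adjacent_intervals (hφ.2.mono_set hsub) hφ₀.2,
      intervalIntegral_congr_uIoc (g := fun s => (t - s) ^ (1 - α - 1) * G s)
        (fun x hx => by simp only [hGneg le_rfl hτ' hx] :
          EqOn (fun s => (t - s) ^ (1 - α - 1) * deriv φ s) _ (Ι (-τ) 0)),
      intervalIntegral_congr_uIoc (g := fun s => (t - s) ^ (1 - α - 1) * G s)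
        (fun x hx => by simp only [hGpos ht.le hx] :
          EqOn (fun s => (t - s) ^ (1 - α - 1) * deriv y s) _ (Ι 0 t))]
    ring
  rw [hvalue]
  exact hmain

end FracDelay

theorem mainTheorem1 (α τ : ℝ) (hα₀ : 0 < α) (hα₁ : α < 1) (hτ : 0 < τ) (φ : ℝ → ℝ) :
    (∀ (y : ℝ → ℝ) (t : ℝ), 0 < t → y 0 = φ 0 →
      FracDelay.CaputoDifferentiableAt α 0 y t →
      FracDelay.CaputoDifferentiableAt α (-τ) φ t →
        FracDelay.CaputoDifferentiableAt α 0 φ t ∧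
        FracDelay.HasModifiedGLDerivAt α τ φ y
          (FracDelay.caputoDeriv α 0 y t + FracDelay.caputoDeriv α (-τ) φ t
            - FracDelay.caputoDeriv α 0 φ t) t) ∧
    (∀ (T : ℝ) (g : ℝ → ℝ → ℝ → ℝ) (y : ℝ → ℝ), 0 < T →
      (∀ t ∈ Ioc 0 T, FracDelay.CaputoDifferentiableAt α (-τ) φ t) →
        ((FracDelay.IsModifiedSolution α τ T g φ y ∧
            ∀ t ∈ Ioc 0 T, FracDelay.CaputoDifferentiableAt α 0 y t) ↔
          FracDelay.IsCaputoSolution α τ T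
            (fun t u v => g t u v + FracDelay.caputoDeriv α 0 φ t
              - FracDelay.caputoDeriv α (-τ) φ t) φ y)) := by
  have main := fun (y : ℝ → ℝ) (t : ℝ) (ht : 0 < t) (h₀ : y 0 = φ 0) =>
    FracDelay.hasModifiedGLDerivAt_of_caputo (φ := φ) (y := y) hα₀ hα₁ hτ.le ht h₀
  refine ⟨fun y t ht h₀ hy hφ => ⟨hφ.mono_left (by linarith) ht.le, main y t ht h₀ hy hφ⟩, ?_⟩
  intro T g y _ hφ
  have hmem : (0 : ℝ) ∈ Icc (-τ) 0 := ⟨by linarith, le_rfl⟩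
  constructor
  · rintro ⟨hsol, hy⟩
    refine ⟨hsol.continuousOn, hsol.initial, hy, fun t ht => ?_⟩
    have huniq := tendsto_nhds_unique (hsol.equation t ht).2
      (main y t ht.1 (hsol.initial 0 hmem) (hy t ht) (hφ t ht)).2
    linarith
  · intro hsol
    refine ⟨⟨hsol.continuousOn, hsol.initial, fun t ht => ?_⟩, hsol.differentiable⟩
    have h := main y t ht.1 (hsol.initial 0 hmem) (hsol.differentiable t ht) (hφ t ht)
    rw [hsol.equation t ht] at h
    convert h using 1
    ring
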